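/- Let $n\in\mathbb N$, let $A,B:\mathbb{R}\to\mathbb{R}^{n\times n}$ be continuous and $1$-periodic, and let $\tau\in[0,1)$. For $N\in\mathbb{N}$ let $M_N$ be the time-$1$ map of $\dot x(t)=A(t)x(t)+B(t)x(t-\tau-N)$ on $C([-\tau-N,0];\mathbb{C}^n)$; $\mu\in\mathbb{C}$ is a Floquet exponent of $M_N$ if $e^{\mu}$ is an eigenvalue of $M_N$. Let $\Sigma_A$ be the set of all $\mu\in\mathbb{C}$ for which $\dot y=(A(t)-\mu I)y$ on $[-1,0]$, $y(0)=y(-1)$, has a non-trivial solution $y\in C^1([-1,0];\mathbb{C}^n)$. Let $\mathcal{A}_c$ be the set of all $\gamma+i\omega$ with $\gamma\in\mathbb{R}$, $\omega\in[-\pi,\pi)$, such that for some $\varphi\in\mathbb{R}$ the problem $$\dot y(t)=(A(t)-i\omega I)y(t)+e^{-\gamma-i\varphi}B(t)\,y\big((t-\tau)_{\mathrm{mod}[-1,0]}\big)\ \ (t\in[-1,0]),\qquad y(0)=y(-1),$$ has a non-trivial solution $y\in C^1([-1,0];\mathbb{C}^n)$, where $s_{\mathrm{mod}[-1,0]}=s+k$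 if $s\in[-k-1,-k)$, $k\in\mathbb{Z}$. For $R,R_2\in\mathbb{R}$, a number $\gamma+i\omega$ with $\gamma\in[-R,R_2]$ and $\omega\in[-\pi,\pi)$ is called a scaled Floquet exponent of $M_N$ (for the window $[-R,R_2]$) if $\gamma/(N+\tau)+i\omega$ is a Floquet exponent of $M_N$. Assume that $\Sigma_A$ contains no point of the imaginary axis, and let $\gamma_*+i\omega_*\in\mathcal{A}_c$ with $\gamma_*\in[-R,R_2]$. Then there are real sequences $(\gamma_N)$, $(\omega_N)$ with $\gamma_N+i\omega_N\to\gamma_*+i\omega_*$ as $N\to\infty$ such that for all sufficiently large $N$ one has $\omega_N\in[-\pi,\pi)$ and $\gamma_N/(N+\tau)+i\omega_N$ is a Floquet exponent of $M_N$. If moreover $-R<\gamma_*<R_2$, then $\gamma_N+i\omega_N$ is a scaled Floquet exponent of $M_N$ for the window $[-R,R_2]$ for all sufficiently large $N$. If $\gamma_*>0$, then for all sufficiently large $N$ the map $M_N$ has an eigenvalue of modulus greater than $1$. -/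

import Mathlib

open Filter Topology Set

namespace LargeDelayDDE

/-- The action of a real `n × n` matrix on a vector of `ℂⁿ`. -/
noncomputable def act {n : ℕ} (A : Matrix (Fin n) (Fin n) ℝ) (v : Fin n → ℂ) : Fin n → ℂ :=
  (A.map Complex.ofReal).mulVec v

/-- Reduction modulo `[-1,0]`: `wrap s = s + k` if `s ∈ [-k-1, -k)` with `k` an integer. -/
noncomputable def wrap (s : ℝ) : ℝ := Int.fract s - 1

/-- The graph of the time-one map `M : C([-r,0]; ℂⁿ) → C([-r,0]; ℂⁿ)` of the linear delay
differential equation `x'(t) = A(t) x(t) + B(t) x(t - r)`: there is a solution `x` on `[-r,1]`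
with history `φ` on `[-r,0]`, and the history of `x` at time `1` is `ψ`. -/
def TimeOneMap {n : ℕ} (A B : ℝ → Matrix (Fin n) (Fin n) ℝ) (r : ℝ)
    (φ ψ : C(Icc (-r) (0 : ℝ), Fin n → ℂ)) : Prop :=
  ∃ x : ℝ → Fin n → ℂ,
    ContinuousOn x (Icc (-r) 1) ∧
    (∀ θ : Icc (-r) (0 : ℝ), x θ = φ θ) ∧
    (∀ t ∈ Icc (0 : ℝ) 1,
      HasDerivWithinAt x (act (A t) (x t) + act (B t) (x (t - r))) (Icc 0 1) t) ∧
    (∀ θ : Icc (-r) (0 : ℝ), x (θ + 1) = ψ θ)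

/-- `ev` is an eigenvalue of `M_N`, the time-one map for the delay `τ + N`. -/
def IsFloquetMultiplier {n : ℕ} (A B : ℝ → Matrix (Fin n) (Fin n) ℝ) (τ : ℝ) (N : ℕ)
    (ev : ℂ) : Prop :=
  ∃ φ : C(Icc (-(τ + N)) (0 : ℝ), Fin n → ℂ), φ ≠ 0 ∧ TimeOneMap A B (τ + N) φ (ev • φ)

/-- `μ` is a Floquet exponent of `M_N`: `exp μ` is an eigenvalue of `M_N`. -/
def IsFloquetExponent {n : ℕ} (A B : ℝ → Matrix (Fin n) (Fin n) ℝ) (τ : ℝ) (N : ℕ)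
    (μ : ℂ) : Prop :=
  IsFloquetMultiplier A B τ N (Complex.exp μ)

/-- The complex number `γ / (N + τ) + i ω` obtained from `s = γ + i ω`. -/
noncomputable def unscale (τ : ℝ) (N : ℕ) (s : ℂ) : ℂ :=
  ((s.re / (N + τ) : ℝ) : ℂ) + (s.im : ℂ) * Complex.I

/-- `s = γ + i ω` is a scaled Floquet exponent of `M_N` (for the window `γ ∈ [-R, R₂]`). -/
def IsScaledFloquetExponent {n : ℕ} (A B : ℝ → Matrix (Fin n) (Fin n) ℝ) (τ : ℝ) (N : ℕ)
    (R R₂ : ℝ) (s : ℂ) : Prop :=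
  s.re ∈ Icc (-R) R₂ ∧ s.im ∈ Ico (-Real.pi) Real.pi ∧
    IsFloquetExponent A B τ N (unscale τ N s)

/-- The instantaneous spectrum `Σ_A`: all `μ` for which `y' = (A(t) - μ) y` on `[-1,0]`,
`y(0) = y(-1)`, has a non-trivial solution. (Solutions are automatically `C¹` on `[-1,0]` when
`A` is continuous.) -/
def instantaneousSpectrum {n : ℕ} (A : ℝ → Matrix (Fin n) (Fin n) ℝ) : Set ℂ :=
  {μ | ∃ y : ℝ → Fin n → ℂ,
    (∃ t ∈ Icc (-1 : ℝ) 0, y t ≠ 0) ∧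
    (∀ t ∈ Icc (-1 : ℝ) 0,
      HasDerivWithinAt y (act (A t) (y t) - μ • y t) (Icc (-1) 0) t) ∧
    y 0 = y (-1)}

/-- The asymptotic continuous spectrum `A_c`: all `γ + i ω` with `ω ∈ [-π, π)` such that, for some
phase `φ`, the problem `y'(t) = (A(t) - i ω) y(t) + exp(-γ - i φ) B(t) y((t - τ) mod [-1,0])` on
`[-1,0]`, `y(0) = y(-1)`, has a non-trivial solution. (Solutions are automatically `C¹` on `[-1,0]`
when `A` and `B` are continuous, since the right-hand side is continuous by `y(0) = y(-1)`.) -/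
def asymptoticContinuousSpectrum {n : ℕ} (A B : ℝ → Matrix (Fin n) (Fin n) ℝ) (τ : ℝ) :
    Set ℂ :=
  {s | s.im ∈ Ico (-Real.pi) Real.pi ∧ ∃ φ : ℝ, ∃ y : ℝ → Fin n → ℂ,
    (∃ t ∈ Icc (-1 : ℝ) 0, y t ≠ 0) ∧
    (∀ t ∈ Icc (-1 : ℝ) 0,
      HasDerivWithinAt y
        (act (A t) (y t) - ((s.im : ℂ) * Complex.I) • y t
          + Complex.exp (-(s.re : ℂ) - Complex.I * φ) • act (B t) (y (wrap (t - τ))))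
        (Icc (-1) 0) t) ∧
    y 0 = y (-1)}

end LargeDelayDDE

/-! The Floquet ansatz `x t = exp (μ t) Y t` with `Y` of period 1 turns the delay equation into `Y'
= (A - μ) Y + z B Y(· - τ)`, with `z = exp (-μ (τ + N))`; the delay survives only modulo 1 and in
`z`. Inverting `y ↦ y' + y` on periodic functions makes this a fixed point equation `Y = K(μ, z) Y`
with `K` compact.

Write `r = τ + N` and choose `ω'` near `ω` with `ω' r ≡ φ` modulo `2π`. For `μ = i ω' + ζ / r` one
gets `z = exp (-ζ - i φ)`, so `N` enters only through the small parameters `i (ω' - ω)` and `1 / r`.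
At parameters zero, the singular point `ζ = γ` is exactly the hypothesis that `γ + i ω` lies in
`A_c`.

This singular point is isolated (`eventually_isUnit`): as `i ω ∉ Σ_A`, `1 - K(i ω, 0)` is
invertible, and the other singular `ζ` correspond to nonzero eigenvalues of one compact operator. A
Hurwitz argument (`eventually_exists_not_isUnit`) then yields a singular `ζ` near `γ` for every
large `N`, that is, a Floquet exponent. -/

namespace LargeDelayDDE

/-! ### Analytic families and compact operators -/

/-- An operator-valued version of Hurwitz's theorem: singular points of a holomorphic family in a
Banach algebra persist under perturbation. -/
theorem eventually_exists_not_isUnit {𝔸 P : Type*} [NormedRing 𝔸] [NormedAlgebra ℂ 𝔸]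
    [CompleteSpace 𝔸] [TopologicalSpace P] {p₀ : P} {G : P → ℂ → 𝔸} {z₀ : ℂ} {ρ : ℝ}
    (hρ : 0 < ρ) (hG : Continuous fun q : P × ℂ => G q.1 q.2)
    (hd : ∀ p, Differentiable ℂ (G p))
    (hs : ∀ z ∈ Metric.sphere z₀ ρ, IsUnit (G p₀ z)) (h0 : ¬ IsUnit (G p₀ z₀)) :
    ∀ᶠ p in 𝓝 p₀, ∃ z ∈ Metric.ball z₀ ρ, ¬ IsUnit (G p z) := by
  have hinv : ∀ z ∈ Metric.sphere z₀ ρ,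
      ContinuousAt (fun q : P × ℂ => Ring.inverse (G q.1 q.2)) (p₀, z) := by
    intro z hz
    obtain ⟨u, hu⟩ := hs z hz
    have := NormedRing.inverse_continuousAt u
    rw [hu] at this
    exact ContinuousAt.comp (f := fun q : P × ℂ => G q.1 q.2) (x := (p₀, z)) this hG.continuousAt
  obtain ⟨C, hC⟩ : ∃ C, ∀ z ∈ Metric.sphere z₀ ρ, ‖Ring.inverse (G p₀ z)‖ ≤ C := by
    refine (isCompact_sphere z₀ ρ).exists_bound_of_continuousOn fun z hz => ?_
    exact (ContinuousAt.comp (f := fun z : ℂ => (p₀, z)) (hinv z hz)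
      (by fun_prop)).continuousWithinAt
  have hC0 : 0 < |C| + 1 := by positivity
  have h1 : ∀ᶠ p in 𝓝 p₀, ∀ z ∈ Metric.sphere z₀ ρ,
      IsUnit (G p z) ∧ ‖Ring.inverse (G p z)‖ < |C| + 1 := by
    refine (isCompact_sphere z₀ ρ).eventually_forall_of_forall_eventually fun z hz => ?_
    refine Filter.Eventually.and ?_ ?_
    · exact hG.continuousAt.eventually (Units.isOpen.mem_nhds (hs z hz))
    · refine (hinv z hz).norm.eventually_lt continuousAt_const ?_
      have := hC z hz
      have := le_abs_self C
      simp only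
      linarith
  have h2 : ∀ᶠ p in 𝓝 p₀, ‖G p₀ z₀ - G p z₀‖ < (|C| + 1)⁻¹ := by
    have : Continuous fun p => ‖G p₀ z₀ - G p z₀‖ := by
      have h : Continuous fun p => G p z₀ := hG.comp (by fun_prop : Continuous fun p : P => (p, z₀))
      fun_prop
    refine this.continuousAt.eventually_lt continuousAt_const ?_
    simpa using hC0
  filter_upwards [h1, h2] with p hp1 hp2
  by_contra! hcon
  have hunit : ∀ z ∈ Metric.closedBall z₀ ρ, IsUnit (G p z) := by
    intro z hz
    rw [← Metric.ball_union_sphere] at hz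
    exact hz.elim (hcon z) fun h => (hp1 z h).1
  have hdiff : DifferentiableOn ℂ (fun z => Ring.inverse (G p z)) (Metric.closedBall z₀ ρ) := by
    intro z hz
    have h : DifferentiableAt ℂ (Ring.inverse : 𝔸 → 𝔸) (G p z) := by
      exact differentiableAt_inverse (hunit z hz)
    exact (h.comp z (hd p z)).differentiableWithinAt
  -- Were `G p` invertible on the whole ball, its inverse would be holomorphic there, and the
  -- maximum principle carries the bound from the sphere to the centre.
  have hmax := Complex.norm_le_of_forall_mem_frontier_norm_le (C := |C| + 1)
    (Metric.isBounded_ball (x := z₀) (r := ρ))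
    (hdiff.mono Metric.closure_ball_subset_closedBall).diffContOnCl (z := z₀)
    (fun z hz => (hp1 z (Metric.frontier_ball_subset_sphere hz)).2.le)
    (subset_closure (Metric.mem_ball_self hρ))
  obtain ⟨u, hu⟩ := hcon z₀ (Metric.mem_ball_self hρ)
  rw [← hu, Ring.inverse_unit] at hmax
  rcases subsingleton_or_nontrivial 𝔸 with h𝔸 | h𝔸
  · exact h0 (isUnit_of_subsingleton _)
  have hupos : 0 < ‖(↑u⁻¹ : 𝔸)‖ := norm_pos_iff.2 u⁻¹.ne_zero
  -- `G p₀ z₀` is closer to the unit `G p z₀` than the reciprocal norm of the inverse of that unit,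
  -- hence is itself a unit.
  refine h0 ⟨Units.ofNearby u (G p₀ z₀) ?_, rfl⟩
  rw [hu]
  exact hp2.trans_le (inv_anti₀ hupos hmax)

/-- A compact operator has only finitely many eigenvalues outside any ball around the origin. -/
theorem finite_eigenvalues_of_isCompactOperator {X : Type*} [NormedAddCommGroup X]
    [NormedSpace ℂ X] {T : X →L[ℂ] X} (hT : IsCompactOperator T) {c : ℝ} (hc : 0 < c) :
    {μ : ℂ | c ≤ ‖μ‖ ∧ Module.End.HasEigenvalue (T : Module.End ℂ X) μ}.Finite := by
  by_contra hinf
  set S := {μ : ℂ | c ≤ ‖μ‖ ∧ Module.End.HasEigenvalue (T : Module.End ℂ X) μ}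
  let μ : ℕ → ℂ := fun k => (Set.Infinite.natEmbedding S hinf k : ℂ)
  have hμinj : Function.Injective μ :=
    Subtype.val_injective.comp (Set.Infinite.natEmbedding S hinf).injective
  have hμ : ∀ k, μ k ∈ S := fun k => (Set.Infinite.natEmbedding S hinf k).2
  choose e he using fun k => (hμ k).2.exists_hasEigenvector
  have hli : LinearIndependent ℂ e :=
    Module.End.eigenvectors_linearIndependent' (T : Module.End ℂ X) μ hμinj e he
  have hTe : ∀ k, T (e k) = μ k • e k := fun k => (he k).apply_eq_smul
  let V : ℕ → Submodule ℂ X := fun k => Submodule.span ℂ (e '' Iio k)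
  have hVmono : Monotone V := fun a b hab =>
    Submodule.span_mono (image_mono (Iio_subset_Iio hab))
  have hfin : ∀ k, FiniteDimensional ℂ (V k) := fun k =>
    FiniteDimensional.span_of_finite ℂ ((finite_Iio k).image e)
  have hclosed : ∀ k, IsClosed (V k : Set X) := fun k => by
    have := hfin k
    exact (V k).closed_of_finiteDimensional
  have heV : ∀ k, e k ∈ V (k + 1) := fun k => Submodule.subset_span ⟨k, by simp, rfl⟩
  have heV' : ∀ k, e k ∉ V k := fun k => by
    have := hli.notMem_span_image (s := Iio k) (x := k) (by simp)
    exact this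
  have hTV : ∀ k, ∀ v ∈ V k, T v ∈ V k := by
    intro k v hv
    induction hv using Submodule.span_induction with
    | mem x hx =>
      obtain ⟨j, hj, rfl⟩ := hx
      rw [hTe]
      exact Submodule.smul_mem _ _ (Submodule.subset_span ⟨j, hj, rfl⟩)
    | zero => simp
    | add x y _ _ hx hy => rw [map_add]; exact Submodule.add_mem _ hx hy
    | smul a x _ hx => rw [map_smul]; exact Submodule.smul_mem _ _ hx
  -- `T - μ k` kills the top vector `e k` and preserves the lower ones.
  have hTμ : ∀ k, ∀ v ∈ V (k + 1), T v - μ k • v ∈ V k := by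
    intro k v hv
    induction hv using Submodule.span_induction with
    | mem x hx =>
      obtain ⟨j, hj, rfl⟩ := hx
      rw [hTe, ← sub_smul]
      rcases Nat.lt_succ_iff_lt_or_eq.1 hj with h | rfl
      · exact Submodule.smul_mem _ _ (Submodule.subset_span ⟨j, h, rfl⟩)
      · simp
    | zero => simp
    | add x y _ _ hx hy =>
      rw [map_add, smul_add, add_sub_add_comm]; exact Submodule.add_mem _ hx hy
    | smul a x _ hx =>
      rw [map_smul, smul_comm, ← smul_sub]; exact Submodule.smul_mem _ _ hx
  have hx : ∀ k, ∃ x ∈ V (k + 1), ‖x‖ ≤ 3 ∧ ∀ y ∈ V k, 1 ≤ ‖x - y‖ := by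
    intro k
    have h₁ : IsClosed ((V k).comap (V (k + 1)).subtype : Set (V (k + 1))) :=
      (hclosed k).preimage continuous_subtype_val
    obtain ⟨⟨x, hx⟩, hxn, hxy⟩ := riesz_lemma_of_norm_lt (c := (2 : ℂ)) (R := 3) (by norm_num)
      (by norm_num) h₁ ⟨⟨e k, heV k⟩, fun h => heV' k h⟩
    refine ⟨x, hx, hxn, fun y hy => ?_⟩
    exact hxy ⟨y, hVmono (Nat.le_succ k) hy⟩ hy
  choose x hxV hxn hxy using hx
  -- Modulo `V k`, `T (x k) - T (x j)` is `μ k • x k`, and `x k` has distance at least 1 from `V k`.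
  -- The images are thus `c`-separated, against compactness.
  have hsep : ∀ k j, j < k → c ≤ ‖T (x k) - T (x j)‖ := by
    intro k j hjk
    have hμ0 : μ k ≠ 0 := norm_pos_iff.1 (hc.trans_le (hμ k).1)
    have hw : T (x j) - (T (x k) - μ k • x k) ∈ V k :=
      Submodule.sub_mem _ (hTV k _ (hVmono hjk (hxV j))) (hTμ k _ (hxV k))
    have h := hxy k _ (Submodule.smul_mem _ (μ k)⁻¹ hw)
    have heq : T (x k) - T (x j) =
        μ k • (x k - (μ k)⁻¹ • (T (x j) - (T (x k) - μ k • x k))) := by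
      rw [smul_sub, smul_inv_smul₀ hμ0]; abel
    rw [heq, norm_smul]
    nlinarith [(hμ k).1]
  obtain ⟨K, hK, hK'⟩ := hT.image_closedBall_subset_compact 3
  obtain ⟨y, -, ψ, hψ, hψy⟩ :=
    hK.tendsto_subseq (x := fun k => T (x k)) (fun k => hK' ⟨x k, by simpa using hxn k, rfl⟩)
  obtain ⟨N, hN⟩ := Metric.cauchySeq_iff'.1 hψy.cauchySeq c hc
  have := hN (N + 1) (Nat.le_succ N)
  rw [dist_eq_norm] at this
  exact this.not_ge (hsep _ _ (hψ (Nat.lt_succ_self N)))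

/-! ### Operators on periodic functions -/

/-- Continuous `1`-periodic functions with values in `ℂⁿ`. -/
abbrev PeriodicFun (n : ℕ) := C(AddCircle (1 : ℝ), Fin n → ℂ)

@[simp]
theorem act_add {n : ℕ} (A : Matrix (Fin n) (Fin n) ℝ) (v w : Fin n → ℂ) :
    act A (v + w) = act A v + act A w :=
  Matrix.mulVec_add _ _ _

@[simp]
theorem act_smul {n : ℕ} (A : Matrix (Fin n) (Fin n) ℝ) (c : ℂ) (v : Fin n → ℂ) :
    act A (c • v) = c • act A v :=
  Matrix.mulVec_smul _ _ _

theorem continuous_act {n : ℕ} :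
    Continuous fun p : Matrix (Fin n) (Fin n) ℝ × (Fin n → ℂ) => act p.1 p.2 :=
  (continuous_fst.matrix_map Complex.continuous_ofReal).matrix_mulVec continuous_snd

/-- The action of a continuous periodic matrix function on periodic functions. -/
noncomputable def mulOp {n : ℕ} {A : ℝ → Matrix (Fin n) (Fin n) ℝ} (hA : Continuous A)
    (hAper : Function.Periodic A 1) : PeriodicFun n →L[ℂ] PeriodicFun n :=
  have hc : Continuous hAper.lift := continuous_quot_lift _ hA
  { toFun := fun f => ⟨fun x => act (hAper.lift x) (f x),
      continuous_act.comp (hc.prodMk f.continuous)⟩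
    map_add' := fun f g => by ext1 x; simp
    map_smul' := fun c f => by ext1 x; simp
    cont := ContinuousMap.continuous_of_continuous_uncurry _
      (continuous_act.comp ((hc.comp continuous_snd).prodMk
        (by fun_prop : Continuous fun p : PeriodicFun n × AddCircle (1 : ℝ) => p.1 p.2))) }

/-- The translation `f ↦ f (· - τ)` of periodic functions. -/
noncomputable def shiftOp (n : ℕ) (τ : ℝ) : PeriodicFun n →L[ℂ] PeriodicFun n where
  toFun f := ⟨fun x => f (x - (τ : AddCircle (1 : ℝ))), by fun_prop⟩
  map_add' f g := rfl
  map_smul' c f := rfl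
  cont := ContinuousMap.continuous_of_continuous_uncurry _
    (by fun_prop : Continuous fun p : PeriodicFun n × AddCircle (1 : ℝ) =>
      p.1 (p.2 - (τ : AddCircle (1 : ℝ))))

/-- The inverse of `y ↦ y' + y` on periodic functions. -/
noncomputable def greenOp (n : ℕ) : PeriodicFun n →L[ℂ] PeriodicFun n :=
  -- The kernel is the periodic summation of `exp (-u)`, `u ≥ 0`, the causal Green's function of `y'
  -- + y`; the geometric series gives the factor `(1 - exp (-1))⁻¹`.
  have hc : Continuous fun p : PeriodicFun n × AddCircle (1 : ℝ) =>
      (1 - Real.exp (-1))⁻¹ • ∫ u in (0 : ℝ)..1, Real.exp (-u) • p.1 (p.2 - u) := by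
    have : Continuous fun u : ℝ => (u : AddCircle (1 : ℝ)) := AddCircle.continuous_mk' _
    have h : Continuous (Function.uncurry
        fun (p : PeriodicFun n × AddCircle (1 : ℝ)) (u : ℝ) => Real.exp (-u) • p.1 (p.2 - u)) := by
      simp only [Function.uncurry_def]
      fun_prop
    exact (intervalIntegral.continuous_parametric_intervalIntegral_of_continuous'
      (μ := MeasureTheory.volume) h _ _).const_smul (1 - Real.exp (-1))⁻¹
  have hi : ∀ (f : PeriodicFun n) (x : AddCircle (1 : ℝ)), IntervalIntegrable
      (fun u : ℝ => Real.exp (-u) • f (x - u)) MeasureTheory.volume 0 1 := fun f x => by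
    have : Continuous fun u : ℝ => (u : AddCircle (1 : ℝ)) := AddCircle.continuous_mk' _
    exact Continuous.intervalIntegrable (by fun_prop) _ _
  { toFun := fun f => ⟨fun x => (1 - Real.exp (-1))⁻¹ •
        ∫ u in (0 : ℝ)..1, Real.exp (-u) • f (x - u),
      hc.comp (by fun_prop : Continuous fun x : AddCircle (1 : ℝ) => (f, x))⟩
    map_add' := fun f g => by
      ext1 x
      simp only [ContinuousMap.coe_mk, ContinuousMap.add_apply, smul_add]
      rw [intervalIntegral.integral_add (hi f x) (hi g x), smul_add]
    map_smul' := fun c f => by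
      ext1 x
      simp only [ContinuousMap.coe_mk, ContinuousMap.smul_apply, RingHom.id_apply]
      simp_rw [smul_comm _ c]
      rw [intervalIntegral.integral_smul, smul_comm]
    cont := ContinuousMap.continuous_of_continuous_uncurry _ hc }

theorem greenOp_apply_coe {n : ℕ} (f : PeriodicFun n) (t : ℝ) :
    greenOp n f t = ((1 - Real.exp (-1))⁻¹ * Real.exp (-t)) •
      ∫ u in (t - 1)..t, Real.exp u • f u := by
  have h : (greenOp n f t : Fin n → ℂ) = (1 - Real.exp (-1))⁻¹ •
      ∫ u in (0 : ℝ)..1, Real.exp (-t) • (Real.exp (t - u) • f ((t - u : ℝ))) := by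
    change (1 - Real.exp (-1))⁻¹ • ∫ u in (0 : ℝ)..1,
      Real.exp (-u) • f ((t : AddCircle (1 : ℝ)) - (u : AddCircle (1 : ℝ))) = _
    congr 2 with u : 1
    rw [smul_smul, ← Real.exp_add]
    congr 2
    ring
  rw [h, intervalIntegral.integral_smul,
    intervalIntegral.integral_comp_sub_left (fun u : ℝ => Real.exp u • f u), sub_zero, smul_smul]

theorem hasDerivAt_greenOp {n : ℕ} (f : PeriodicFun n) (t : ℝ) :
    HasDerivAt (fun t : ℝ => greenOp n f t) (f t - greenOp n f t) t := by
  have hcoe : Continuous fun u : ℝ => (u : AddCircle (1 : ℝ)) := AddCircle.continuous_mk' _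
  have hcont : Continuous fun u : ℝ => Real.exp u • f u := by fun_prop
  have hI : ∀ a b, IntervalIntegrable (fun u : ℝ => Real.exp u • f u) MeasureTheory.volume a b :=
    fun a b => hcont.intervalIntegrable a b
  have hF : ∀ t : ℝ, HasDerivAt (fun t => ∫ u in (0 : ℝ)..t, Real.exp u • f u)
      (Real.exp t • f t) t := fun t => hcont.integral_hasStrictDerivAt 0 t |>.hasDerivAt
  have hF1 : HasDerivAt (fun t => ∫ u in (0 : ℝ)..(t - 1), Real.exp u • f u)
      (Real.exp (t - 1) • f t) t := by
    have := (hF (t - 1)).comp_sub_const t 1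
    have h1 : ((t - 1 : ℝ) : AddCircle (1 : ℝ)) = t := by simp
    rwa [h1] at this
  have hG := (hF t).sub hF1
  have hE : HasDerivAt (fun t : ℝ => (1 - Real.exp (-1))⁻¹ * Real.exp (-t))
      ((1 - Real.exp (-1))⁻¹ * -Real.exp (-t)) t := by
    simpa using ((hasDerivAt_id t).neg.exp.const_mul ((1 - Real.exp (-1))⁻¹))
  have hmul := hE.smul hG
  have hfun : (fun t : ℝ => greenOp n f t) = fun t : ℝ =>
      ((1 - Real.exp (-1))⁻¹ * Real.exp (-t)) •
        ((∫ u in (0 : ℝ)..t, Real.exp u • f u) - ∫ u in (0 : ℝ)..(t - 1), Real.exp u • f u) := by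
    funext t
    rw [greenOp_apply_coe, intervalIntegral.integral_interval_sub_left (hI _ _) (hI _ _)]
  have hval := congrFun hfun t
  rw [hfun]
  refine hmul.congr_deriv ?_
  simp only [Pi.sub_apply] at hval ⊢
  rw [hval, mul_neg, neg_smul, ← sub_eq_add_neg, ← sub_smul, smul_smul]
  congr 1
  have hne : 1 - Real.exp (-1) ≠ 0 := by
    have : Real.exp (-1) < 1 := by simp
    linarith
  have h2 : Real.exp (t - 1) = Real.exp t * Real.exp (-1) := by rw [← Real.exp_add]; rfl
  have h3 : Real.exp (-t) * Real.exp t = 1 := by rw [← Real.exp_add]; simp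
  rw [h2, show (1 - Real.exp (-1))⁻¹ * Real.exp (-t) *
    (Real.exp t - Real.exp t * Real.exp (-1)) = ((1 - Real.exp (-1))⁻¹ * (1 - Real.exp (-1))) *
      (Real.exp (-t) * Real.exp t) by ring, h3, inv_mul_cancel₀ hne]
  simp

/-- Arzelà–Ascoli: since the derivative of `greenOp n f` is `f - greenOp n f`, the image of the unit
ball is bounded and uniformly Lipschitz. -/
theorem isCompactOperator_greenOp (n : ℕ) : IsCompactOperator (greenOp n) := by
  let S : Set (PeriodicFun n) := greenOp n '' Metric.ball 0 1
  let Φ := ContinuousMap.isometryEquivBoundedOfCompact (AddCircle (1 : ℝ)) (Fin n → ℂ)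
  have hbd : ∀ f ∈ Metric.ball (0 : PeriodicFun n) 1, ‖greenOp n f‖ ≤ ‖greenOp n‖ := fun f hf =>
    (greenOp n).unit_le_opNorm f (by simpa using (mem_ball_zero_iff.1 hf).le)
  have hlip : ∀ f ∈ Metric.ball (0 : PeriodicFun n) 1, ∀ s t : ℝ,
      dist (greenOp n f s) (greenOp n f t) ≤ (1 + ‖greenOp n‖) * dist s t := by
    intro f hf s t
    rw [dist_eq_norm, dist_eq_norm]
    refine Convex.norm_image_sub_le_of_norm_hasDerivWithin_le (𝕜 := ℝ) (s := univ)
      (f := fun t : ℝ => greenOp n f t)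
      (fun u _ => (hasDerivAt_greenOp f u).hasDerivWithinAt) (fun u _ => ?_) convex_univ
      (mem_univ _) (mem_univ _)
    refine (norm_sub_le _ _).trans (add_le_add ?_ ?_)
    · exact (f.norm_coe_le_norm _).trans (mem_ball_zero_iff.1 hf).le
    · exact ((greenOp n f).norm_coe_le_norm _).trans (hbd f hf)
  have hcomp : IsCompact (closure (Φ '' S)) := by
    refine BoundedContinuousFunction.arzela_ascoli (Metric.closedBall 0 ‖greenOp n‖)
      (isCompact_closedBall _ _) _ ?_ ?_
    · rintro _ x ⟨_, ⟨f, hf, rfl⟩, rfl⟩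
      exact mem_closedBall_zero_iff.2 (((greenOp n f).norm_coe_le_norm _).trans (hbd f hf))
    · intro x
      obtain ⟨t, rfl⟩ := QuotientAddGroup.mk_surjective x
      rw [Metric.equicontinuousAt_iff_right]
      intro ε hε
      rw [QuotientAddGroup.nhds_eq, eventually_map]
      have : ∀ᶠ s in 𝓝 t, (1 + ‖greenOp n‖) * dist t s < ε := by
        have hc : Continuous fun s => (1 + ‖greenOp n‖) * dist t s := by fun_prop
        exact hc.continuousAt.eventually_lt continuousAt_const (by simpa using hε)
      filter_upwards [this] with s hs
      rintro ⟨_, _, ⟨f, hf, rfl⟩, rfl⟩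
      exact (hlip f hf t s).trans_lt hs
  rw [isCompactOperator_iff_exists_mem_nhds_image_subset_compact]
  refine ⟨Metric.ball 0 1, Metric.ball_mem_nhds _ one_pos, Φ ⁻¹' closure (Φ '' S),
    Φ.toHomeomorph.isCompact_preimage.2 hcomp, ?_⟩
  intro g hg
  exact subset_closure (mem_image_of_mem _ hg)

/-! ### From `[-1,0]` to the circle -/

theorem coe_wrap (s : ℝ) : ((wrap s : ℝ) : AddCircle (1 : ℝ)) = s := by
  have h : wrap s = s - ((⌊s⌋ + 1 : ℤ) : ℝ) * 1 := by
    unfold wrap Int.fract; push_cast; ring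
  rw [h, AddCircle.coe_sub, ← zsmul_eq_mul, AddCircle.coe_zsmul, AddCircle.coe_period]
  simp

theorem coe_zero_eq_coe_neg_one :
    ((0 : ℝ) : AddCircle (1 : ℝ)) = ((-1 : ℝ) : AddCircle (1 : ℝ)) := by simp

theorem wrap_mem_Ico (s : ℝ) : wrap s ∈ Ico (-1 : ℝ) 0 :=
  ⟨by unfold wrap; linarith [Int.fract_nonneg s], by unfold wrap; linarith [Int.fract_lt_one s]⟩

/-- A function `y` on `[-1,0]` with `y 0 = y (-1)`, as a periodic function. -/
theorem exists_periodicFun {n : ℕ} {y : ℝ → Fin n → ℂ} (hy : ContinuousOn y (Icc (-1) 0))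
    (h0 : y 0 = y (-1)) : ∃ Y : PeriodicFun n, ∀ t ∈ Icc (-1 : ℝ) 0, Y t = y t := by
  refine ⟨⟨AddCircle.liftIco 1 (-1) y, AddCircle.liftIco_continuous (by simpa using h0.symm)
    (by simpa using hy)⟩, fun t ht => ?_⟩
  rcases ht.2.lt_or_eq with h | rfl
  · exact AddCircle.liftIco_coe_apply ⟨ht.1, by simpa using h⟩
  · refine Eq.trans ?_ h0.symm
    rw [coe_zero_eq_coe_neg_one]
    exact AddCircle.liftIco_coe_apply ⟨le_rfl, by norm_num⟩

/-- `exp t • W t` is constant, and comparing the ends of a period forces `W = 0` because `exp (-1) ≠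
1`. This is the uniqueness behind `greenOp`. -/
theorem eq_zero_of_hasDerivWithinAt_neg {n : ℕ} (W : PeriodicFun n)
    (hW : ∀ t ∈ Icc (-1 : ℝ) 0, HasDerivWithinAt (fun t : ℝ => W t) (-W t) (Icc (-1) 0) t) :
    W = 0 := by
  have hE : ∀ t ∈ Icc (-1 : ℝ) 0,
      HasDerivWithinAt (fun t : ℝ => Real.exp t • W t) 0 (Icc (-1) 0) t := by
    intro t ht
    refine ((Real.hasDerivAt_exp t).hasDerivWithinAt.smul (hW t ht)).congr_deriv ?_
    rw [smul_neg, neg_add_cancel]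
  have hconst : ∀ t ∈ Icc (-1 : ℝ) 0, Real.exp t • W t =
      Real.exp (-1) • (W ((-1 : ℝ) : AddCircle (1 : ℝ)) : Fin n → ℂ) := by
    refine constant_of_derivWithin_zero (f := fun t : ℝ => Real.exp t • W t)
      (fun t ht => (hE t ht).differentiableWithinAt) fun t ht => ?_
    exact (hE t (Ico_subset_Icc_self ht)).derivWithin
      (uniqueDiffOn_Icc (by norm_num) t (Ico_subset_Icc_self ht))
  have hz : (W ((-1 : ℝ) : AddCircle (1 : ℝ)) : Fin n → ℂ) = 0 := by
    have h := hconst 0 (by norm_num)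
    rw [coe_zero_eq_coe_neg_one, Real.exp_zero, ← sub_eq_zero, ← sub_smul, smul_eq_zero] at h
    refine h.resolve_left ?_
    have : Real.exp (-1) < 1 := by simp
    linarith
  ext1 x
  obtain ⟨t, rfl⟩ := QuotientAddGroup.mk_surjective x
  have h := hconst (wrap t) (Ico_subset_Icc_self (wrap_mem_Ico t))
  rw [hz, smul_zero, smul_eq_zero, coe_wrap] at h
  exact h.resolve_left (Real.exp_ne_zero _)

/-! ### The compact family and its singular points -/

section Family

variable {n : ℕ} {A B : ℝ → Matrix (Fin n) (Fin n) ℝ} (hA : Continuous A) (hB : Continuous B)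
  (hAper : Function.Periodic A 1) (hBper : Function.Periodic B 1) (τ : ℝ)

/-- The compact operator whose fixed points are the `1`-periodic solutions of
`y'(t) = (A(t) - μ) y(t) + z B(t) y(t - τ)`. -/
noncomputable def periodicOp (μ z : ℂ) : PeriodicFun n →L[ℂ] PeriodicFun n :=
  greenOp n * (mulOp hA hAper + (1 - μ) • 1 + z • (mulOp hB hBper * shiftOp n τ))

theorem isCompactOperator_periodicOp (μ z : ℂ) :
    IsCompactOperator (periodicOp hA hB hAper hBper τ μ z) :=
  (isCompactOperator_greenOp n).comp_clm _

theorem hasDerivAt_of_periodicOp_eq {μ z : ℂ} {Y : PeriodicFun n}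
    (hY : periodicOp hA hB hAper hBper τ μ z Y = Y) (t : ℝ) :
    HasDerivAt (fun t : ℝ => Y t)
      (act (A t) (Y t) - μ • Y t + z • act (B t) (Y ((t - τ : ℝ) : AddCircle (1 : ℝ)))) t := by
  have h := hasDerivAt_greenOp
    ((mulOp hA hAper + (1 - μ) • 1 + z • (mulOp hB hBper * shiftOp n τ)) Y) t
  change HasDerivAt (fun t : ℝ => periodicOp hA hB hAper hBper τ μ z Y t)
    (_ - periodicOp hA hB hAper hBper τ μ z Y t) t at h
  rw [hY] at h
  refine h.congr_deriv ?_
  change act (A t) (Y t) + (1 - μ) • Y t +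
    z • act (B t) (Y ((t - τ : ℝ) : AddCircle (1 : ℝ))) - Y t = _
  rw [sub_smul, one_smul]
  abel

theorem exists_periodicOp_eq {μ z : ℂ} {y : ℝ → Fin n → ℂ}
    (hne : ∃ t ∈ Icc (-1 : ℝ) 0, y t ≠ 0)
    (hy : ∀ t ∈ Icc (-1 : ℝ) 0, HasDerivWithinAt y
      (act (A t) (y t) - μ • y t + z • act (B t) (y (wrap (t - τ)))) (Icc (-1) 0) t)
    (h0 : y 0 = y (-1)) :
    ∃ Y : PeriodicFun n, Y ≠ 0 ∧ periodicOp hA hB hAper hBper τ μ z Y = Y := by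
  obtain ⟨Y, hY⟩ := exists_periodicFun (fun t ht => (hy t ht).continuousWithinAt) h0
  refine ⟨Y, ?_, ?_⟩
  · rintro rfl
    obtain ⟨t, ht, hyt⟩ := hne
    exact hyt (hY t ht).symm
  set g := (mulOp hA hAper + (1 - μ) • 1 + z • (mulOp hB hBper * shiftOp n τ)) Y
  have hg : ∀ t : ℝ, g t = act (A t) (Y t) + (1 - μ) • Y t +
    z • act (B t) (Y ((t - τ : ℝ) : AddCircle (1 : ℝ))) := fun t => rfl
  change greenOp n g = Y
  rw [← sub_eq_zero]
  -- Both `greenOp n g` and `Y` solve `w' + w = g`, so their difference solves the homogeneous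
  -- equation.
  refine eq_zero_of_hasDerivWithinAt_neg _ fun t ht => ?_
  have hY' : HasDerivWithinAt (fun t : ℝ => Y t) (g t - Y t) (Icc (-1) 0) t := by
    refine ((hy t ht).congr_of_mem hY ht).congr_deriv ?_
    rw [hg, ← coe_wrap (t - τ), hY t ht, hY _ (Ico_subset_Icc_self (wrap_mem_Ico _)), sub_smul,
      one_smul]
    abel
  refine ((hasDerivAt_greenOp g t).hasDerivWithinAt.sub hY').congr_deriv ?_
  change _ = -(greenOp n g t - Y t)
  abel

/-- The Fredholm alternative for a compact operator at the value 1. -/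
theorem exists_periodicOp_eq_of_not_isUnit {μ z : ℂ}
    (h : ¬ IsUnit (1 - periodicOp hA hB hAper hBper τ μ z)) :
    ∃ Y : PeriodicFun n, Y ≠ 0 ∧ periodicOp hA hB hAper hBper τ μ z Y = Y := by
  rcases (isCompactOperator_periodicOp hA hB hAper hBper τ μ z).hasEigenvalue_or_mem_resolventSet
    one_ne_zero with h1 | h1
  · obtain ⟨Y, hY⟩ := h1.exists_hasEigenvector
    exact ⟨Y, hY.2, by simpa using hY.apply_eq_smul⟩
  · rw [spectrum.mem_resolventSet_iff, map_one] at h1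
    exact absurd h1 h

theorem not_isUnit_of_periodicOp_eq {μ z : ℂ} {Y : PeriodicFun n} (h0 : Y ≠ 0)
    (hY : periodicOp hA hB hAper hBper τ μ z Y = Y) :
    ¬ IsUnit (1 - periodicOp hA hB hAper hBper τ μ z) := by
  intro h
  refine h0 ((ContinuousLinearMap.isUnit_iff_bijective.1 h).1 ?_)
  rw [map_zero]
  change Y - periodicOp hA hB hAper hBper τ μ z Y = 0
  rw [hY, sub_self]

theorem isUnit_of_notMem_instantaneousSpectrum {μ : ℂ} (hμ : μ ∉ instantaneousSpectrum A) :
    IsUnit (1 - periodicOp hA hB hAper hBper τ μ 0) := by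
  by_contra h
  obtain ⟨Y, hY0, hY⟩ := exists_periodicOp_eq_of_not_isUnit hA hB hAper hBper τ h
  refine hμ ⟨fun t : ℝ => Y t, ?_, fun t _ => ?_,
    congrArg Y coe_zero_eq_coe_neg_one⟩
  · by_contra! hcon
    refine hY0 ?_
    ext1 x
    obtain ⟨t, rfl⟩ := QuotientAddGroup.mk_surjective x
    have := hcon (wrap t) (Ico_subset_Icc_self (wrap_mem_Ico t))
    rwa [coe_wrap] at this
  · simpa using (hasDerivAt_of_periodicOp_eq hA hB hAper hBper τ hY t).hasDerivWithinAt

/-- With `u = 1 - K(μ, 0)` invertible, `Y = K(μ, z) Y` says that `Y` is an eigenvector of the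
compact operator `T` for `z⁻¹ = exp (ζ + φ)`. Near `ζ₀` this number stays away from 0, where `T` has
only finitely many eigenvalues. -/
theorem eventually_isUnit {μ : ℂ} (hμ : μ ∉ instantaneousSpectrum A) (φ ζ₀ : ℂ) :
    ∀ᶠ ζ in 𝓝[≠] ζ₀, IsUnit (1 - periodicOp hA hB hAper hBper τ μ (Complex.exp (-ζ - φ))) := by
  obtain ⟨u, hu⟩ := isUnit_of_notMem_instantaneousSpectrum hA hB hAper hBper τ hμ
  let T : PeriodicFun n →L[ℂ] PeriodicFun n :=
    ↑u⁻¹ * (greenOp n * (mulOp hB hBper * shiftOp n τ))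
  have hT : IsCompactOperator T := ((isCompactOperator_greenOp n).comp_clm _).clm_comp _
  have hexp : Continuous fun ζ : ℂ => ‖Complex.exp (ζ + φ)‖ := by fun_prop
  have hlow : ∀ᶠ ζ in 𝓝[≠] ζ₀, ‖Complex.exp (ζ₀ + φ)‖ / 2 < ‖Complex.exp (ζ + φ)‖ :=
    (continuousAt_const.eventually_lt hexp.continuousAt
      (half_lt_self (norm_pos_iff.2 (Complex.exp_ne_zero _)))).filter_mono nhdsWithin_le_nhds
  have hc : 0 < ‖Complex.exp (ζ₀ + φ)‖ / 2 := half_pos (norm_pos_iff.2 (Complex.exp_ne_zero _))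
  -- The derivative of `exp` never vanishes, so on a punctured neighbourhood each of these
  -- eigenvalues is avoided, including the value taken at `ζ₀`.
  have hne := (eventually_all_finite (finite_eigenvalues_of_isCompactOperator hT hc)).2
    fun lam _ => ((hasDerivAt_id ζ₀).add_const φ).cexp.eventually_ne (c := lam)
      (by simp)
  filter_upwards [hlow, hne] with ζ hζ hζ'
  by_contra h
  obtain ⟨Y, hY0, hY⟩ := exists_periodicOp_eq_of_not_isUnit hA hB hAper hBper τ h
  refine hζ' (Complex.exp (ζ + φ)) ⟨hζ.le, ?_⟩ rfl
  refine Module.End.hasEigenvalue_of_hasEigenvector (x := Y) ⟨?_, hY0⟩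
  rw [Module.End.mem_eigenspace_iff]
  have hsplit : (u : PeriodicFun n →L[ℂ] PeriodicFun n) Y =
      Complex.exp (-ζ - φ) • (greenOp n * (mulOp hB hBper * shiftOp n τ)) Y := by
    rw [hu]
    have h1 : greenOp n (mulOp hA hAper Y + (1 - μ) • Y +
      Complex.exp (-ζ - φ) • mulOp hB hBper (shiftOp n τ Y)) = Y := hY
    have h2 : periodicOp hA hB hAper hBper τ μ 0 Y = greenOp n (mulOp hA hAper Y + (1 - μ) • Y) :=
      congrArg (greenOp n) ((congrArg (mulOp hA hAper Y + (1 - μ) • Y + ·)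
        (zero_smul ℂ (mulOp hB hBper (shiftOp n τ Y)))).trans (add_zero _))
    rw [map_add, map_smul] at h1
    change Y - periodicOp hA hB hAper hBper τ μ 0 Y = _
    rw [h2]
    exact sub_eq_of_eq_add' h1.symm
  have hinv : (↑u⁻¹ : PeriodicFun n →L[ℂ] PeriodicFun n) (u.1 Y) = Y := by
    change ((↑u⁻¹ : PeriodicFun n →L[ℂ] PeriodicFun n) * u.1) Y = Y
    rw [Units.inv_mul]
    rfl
  have key : Y = Complex.exp (-ζ - φ) • T Y := by
    conv_lhs => rw [← hinv, hsplit, map_smul]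
    rfl
  change T Y = Complex.exp (ζ + φ) • Y
  conv_rhs => rw [key, smul_smul, ← Complex.exp_add]
  simp

end Family

/-! ### Floquet exponents and the perturbation argument -/

theorem isFloquetExponent_of_periodicOp_eq {n : ℕ} {A B : ℝ → Matrix (Fin n) (Fin n) ℝ}
    (hA : Continuous A) (hB : Continuous B) (hAper : Function.Periodic A 1)
    (hBper : Function.Periodic B 1) {τ : ℝ} (hτ : 0 ≤ τ) {N : ℕ} (hN : 1 ≤ N) {μ : ℂ}
    {Y : PeriodicFun n} (h0 : Y ≠ 0)
    (hY : periodicOp hA hB hAper hBper τ μ (Complex.exp (-μ * (τ + N))) Y = Y) :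
    IsFloquetExponent A B τ N μ := by
  have hcoe : Continuous fun u : ℝ => (u : AddCircle (1 : ℝ)) := AddCircle.continuous_mk' _
  let x : ℝ → Fin n → ℂ := fun t => Complex.exp (μ * t) • Y t
  have hx : Continuous x := by
    change Continuous fun t : ℝ => Complex.exp (μ * t) • Y t
    fun_prop
  -- The history interval then contains a full period, so a nonzero `Y` gives a nonzero history.
  have hr : (1 : ℝ) ≤ τ + N := by
    have : (1 : ℝ) ≤ N := by exact_mod_cast hN
    linarith
  refine ⟨⟨fun θ => x θ, by fun_prop⟩, ?_, x, hx.continuousOn, fun _ => rfl, fun t _ => ?_,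
    fun θ => ?_⟩
  · intro hφ
    refine h0 ?_
    ext1 p
    obtain ⟨t, rfl⟩ := QuotientAddGroup.mk_surjective p
    have hw := wrap_mem_Ico t
    have h := DFunLike.congr_fun hφ ⟨wrap t, by linarith [hw.1], hw.2.le⟩
    change Complex.exp (μ * wrap t) • (Y (wrap t) : Fin n → ℂ) = 0 at h
    rw [coe_wrap, smul_eq_zero] at h
    exact h.resolve_left (Complex.exp_ne_zero _)
  · have hd := hasDerivAt_of_periodicOp_eq hA hB hAper hBper τ hY t
    have hE : HasDerivAt (fun t : ℝ => Complex.exp (μ * t)) (Complex.exp (μ * t) * μ) t := by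
      simpa using ((hasDerivAt_id (t : ℂ)).const_mul μ).cexp.comp_ofReal
    refine ((hE.smul hd).congr_deriv ?_).hasDerivWithinAt
    have hper : ((t - (τ + N) : ℝ) : AddCircle (1 : ℝ)) = ((t - τ : ℝ) : AddCircle (1 : ℝ)) := by
      have : (t - (τ + N) : ℝ) = t - τ - N • (1 : ℝ) := by simp; ring
      rw [this, AddCircle.coe_sub, AddCircle.coe_nsmul, AddCircle.coe_period]
      simp
    simp only [x, hper, act_smul, smul_add, smul_sub, smul_smul]
    have hexp : Complex.exp (μ * t) * Complex.exp (-μ * (τ + N)) =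
        Complex.exp (μ * ((t - (τ + N) : ℝ) : ℂ)) := by
      rw [← Complex.exp_add]
      congr 1
      push_cast
      ring
    rw [hexp]
    abel
  · change Complex.exp (μ * ((θ + 1 : ℝ) : ℂ)) • (Y ((θ + 1 : ℝ) : AddCircle (1 : ℝ)) : Fin n → ℂ) =
      Complex.exp μ • Complex.exp (μ * ((θ : ℝ) : ℂ)) • Y ((θ : ℝ) : AddCircle (1 : ℝ))
    rw [smul_smul, ← Complex.exp_add, AddCircle.coe_add, AddCircle.coe_period, add_zero]
    congr 2
    push_cast
    ring

theorem continuous_one_sub_mul_pencil {𝔸 P : Type*} [NormedRing 𝔸] [NormedAlgebra ℂ 𝔸]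
    [TopologicalSpace P] (a b c : 𝔸) {f g : P → ℂ} (hf : Continuous f) (hg : Continuous g) :
    Continuous fun p => 1 - a * (b + (1 - f p) • 1 + g p • c) := by
  fun_prop

theorem differentiable_one_sub_mul_pencil {𝔸 : Type*} [NormedRing 𝔸] [NormedAlgebra ℂ 𝔸]
    (a b c : 𝔸) {f g : ℂ → ℂ} (hf : Differentiable ℂ f) (hg : Differentiable ℂ g) :
    Differentiable ℂ fun p => 1 - a * (b + (1 - f p) • 1 + g p • c) := by
  fun_prop

/-- The Hurwitz theorem on a circle around `ζ₀` small enough to contain no other singular point. In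
the application `p` is `(i (ω' - ω), 1 / (τ + N))`. -/
theorem eventually_exists_periodicOp_eq {n : ℕ} {A B : ℝ → Matrix (Fin n) (Fin n) ℝ}
    (hA : Continuous A) (hB : Continuous B) (hAper : Function.Periodic A 1)
    (hBper : Function.Periodic B 1) (τ : ℝ) {μ φ ζ₀ : ℂ} (hμ : μ ∉ instantaneousSpectrum A)
    {Y : PeriodicFun n} (h0 : Y ≠ 0)
    (hY : periodicOp hA hB hAper hBper τ μ (Complex.exp (-ζ₀ - φ)) Y = Y) {ε : ℝ} (hε : 0 < ε) :
    ∀ᶠ p : ℂ × ℂ in 𝓝 0, ∃ ζ ∈ Metric.ball ζ₀ ε, ∃ Y : PeriodicFun n, Y ≠ 0 ∧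
      periodicOp hA hB hAper hBper τ (μ + p.1 + p.2 * ζ) (Complex.exp (-ζ - φ)) Y = Y := by
  obtain ⟨δ, hδ, hδu⟩ := Metric.eventually_nhds_iff.1
    (eventually_nhdsWithin_iff.1 (eventually_isUnit hA hB hAper hBper τ hμ φ ζ₀))
  obtain ⟨ρ, hρ0, hρ⟩ := exists_between (lt_min hε hδ)
  have hG : Continuous fun q : (ℂ × ℂ) × ℂ => 1 - periodicOp hA hB hAper hBper τ
      (μ + q.1.1 + q.1.2 * q.2) (Complex.exp (-q.2 - φ)) :=
    continuous_one_sub_mul_pencil (𝔸 := PeriodicFun n →L[ℂ] PeriodicFun n) (greenOp n)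
      (mulOp hA hAper) (mulOp hB hBper * shiftOp n τ)
      (f := fun q : (ℂ × ℂ) × ℂ => μ + q.1.1 + q.1.2 * q.2)
      (g := fun q : (ℂ × ℂ) × ℂ => Complex.exp (-q.2 - φ)) (by fun_prop) (by fun_prop)
  have hd : ∀ p : ℂ × ℂ, Differentiable ℂ fun ζ => 1 - periodicOp hA hB hAper hBper τ
      (μ + p.1 + p.2 * ζ) (Complex.exp (-ζ - φ)) := by
    intro p
    exact differentiable_one_sub_mul_pencil (𝔸 := PeriodicFun n →L[ℂ] PeriodicFun n) (greenOp n)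
      (mulOp hA hAper) (mulOp hB hBper * shiftOp n τ) (f := fun ζ => μ + p.1 + p.2 * ζ)
      (g := fun ζ => Complex.exp (-ζ - φ)) (by fun_prop) (by fun_prop)
  have hev := eventually_exists_not_isUnit (p₀ := (0 : ℂ × ℂ)) (z₀ := ζ₀) (ρ := ρ)
    (G := fun p ζ => 1 - periodicOp hA hB hAper hBper τ
      (μ + p.1 + p.2 * ζ) (Complex.exp (-ζ - φ))) hρ0 hG hd
    (fun z hz => by
      have hz' : dist z ζ₀ = ρ := hz
      simp only [Prod.fst_zero, Prod.snd_zero, add_zero, zero_mul]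
      refine hδu (hz'.trans_lt (hρ.trans_le (min_le_right _ _))) ?_
      rintro rfl
      rw [dist_self] at hz'
      exact hρ0.ne hz')
    (by
      simp only [Prod.fst_zero, Prod.snd_zero, add_zero, zero_mul]
      exact not_isUnit_of_periodicOp_eq hA hB hAper hBper τ h0 hY)
  filter_upwards [hev] with p ⟨ζ, hζ, hu⟩
  exact ⟨ζ, Metric.ball_subset_ball (hρ.trans_le (min_le_left _ _)).le hζ,
    exists_periodicOp_eq_of_not_isUnit hA hB hAper hBper τ hu⟩

/-! ### The limit of large delay -/

/-- If points of `Z N` eventually come arbitrarily close to `a`, there is a sequence converging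
to `a` that eventually lies in `Z N`. -/
theorem exists_seq_tendsto_of_eventually {X : Type*} [PseudoMetricSpace X] {a : X} {Z : ℕ → Set X}
    (h : ∀ ε > 0, ∀ᶠ N in atTop, ∃ x ∈ Z N, dist x a < ε) :
    ∃ s : ℕ → X, Tendsto s atTop (𝓝 a) ∧ ∀ᶠ N in atTop, s N ∈ Z N := by
  classical
  -- A near-minimiser of the distance to `a` serves every `ε` at once; `a` is a dummy value when `Z
  -- N` is empty.
  have hs : ∀ N, ∃ x, (Z N).Nonempty → x ∈ Z N ∧
      dist a x < Metric.infDist a (Z N) + 1 / ((N : ℝ) + 1) := by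
    intro N
    by_cases hN : (Z N).Nonempty
    · obtain ⟨x, hx, hxd⟩ := (Metric.infDist_lt_iff hN).1
        (lt_add_of_pos_right (Metric.infDist a (Z N)) (Nat.one_div_pos_of_nat (n := N)))
      exact ⟨x, fun _ => ⟨hx, hxd⟩⟩
    · exact ⟨a, fun h => absurd h hN⟩
  choose s hs using hs
  refine ⟨s, ?_, ?_⟩
  · rw [Metric.tendsto_nhds]
    intro ε hε
    filter_upwards [h (ε / 2) (half_pos hε), (tendsto_order.1
      (tendsto_one_div_add_atTop_nhds_zero_nat (𝕜 := ℝ))).2 (ε / 2) (half_pos hε)]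
      with N ⟨x, hx, hxa⟩ hN
    have h1 := (hs N ⟨x, hx⟩).2
    have h2 := Metric.infDist_le_dist_of_mem (x := a) hx
    rw [dist_comm] at hxa h1
    linarith
  · filter_upwards [h 1 one_pos] with N ⟨x, hx, _⟩
    exact (hs N ⟨x, hx⟩).1

/-- Near every `ω` there are, for large delay `r`, frequencies slightly above `ω` with prescribed
phase `φ` of `exp (i ω r)`. -/
theorem exists_frequency (ω φ : ℝ) {r : ℝ} (hr : 0 < r) :
    ∃ ω' : ℝ, (∃ m : ℤ, ω' * r = φ + m * (2 * Real.pi)) ∧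
      ω + 1 / r ≤ ω' ∧ ω' ≤ ω + (1 + 2 * Real.pi) / r := by
  have hpi : 0 < 2 * Real.pi := by positivity
  -- The summand 1 forces `ω' ≥ ω + 1 / r`, room for the later correction `ζ.im / r`; this keeps the
  -- frequency in `[-π, π)` even when `ω = -π`.
  set m : ℤ := ⌈(ω * r + 1 - φ) / (2 * Real.pi)⌉
  have h1 : ω * r + 1 - φ ≤ m * (2 * Real.pi) := (div_le_iff₀ hpi).1 (Int.le_ceil _)
  have h2 : m * (2 * Real.pi) < ω * r + 1 - φ + 2 * Real.pi := by
    have := Int.ceil_lt_add_one ((ω * r + 1 - φ) / (2 * Real.pi))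
    have := mul_lt_mul_of_pos_right this hpi
    rwa [add_mul, div_mul_cancel₀ _ hpi.ne', one_mul] at this
  refine ⟨(φ + m * (2 * Real.pi)) / r, ⟨m, div_mul_cancel₀ _ hr.ne'⟩, ?_, ?_⟩
  · rw [le_div_iff₀ hr, add_mul, div_mul_cancel₀ _ hr.ne']; linarith
  · rw [div_le_iff₀ hr, add_mul, div_mul_cancel₀ _ hr.ne']; linarith

theorem eventually_exists_floquetExponent {n : ℕ} {A B : ℝ → Matrix (Fin n) (Fin n) ℝ}
    (hA : Continuous A) (hB : Continuous B) (hAper : Function.Periodic A 1)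
    (hBper : Function.Periodic B 1) {τ : ℝ} (hτ : 0 ≤ τ)
    (hSig : ∀ μ ∈ instantaneousSpectrum A, μ.re ≠ 0) {s : ℂ}
    (hs : s ∈ asymptoticContinuousSpectrum A B τ) {ε : ℝ} (hε : 0 < ε) :
    ∀ᶠ N : ℕ in atTop, ∃ z ∈ {z : ℂ | z.im ∈ Ico (-Real.pi) Real.pi ∧
      IsFloquetExponent A B τ N (unscale τ N z)}, dist z s < ε := by
  obtain ⟨him, φ, y, hne, hy, h0⟩ := hs
  have hμ : (s.im : ℂ) * Complex.I ∉ instantaneousSpectrum A := fun h => hSig _ h (by simp)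
  obtain ⟨Y, hY0, hY⟩ := exists_periodicOp_eq hA hB hAper hBper τ hne hy h0
  rw [mul_comm Complex.I] at hY
  set δ := min (ε / 4) (1 / 2)
  have hδ : 0 < δ := lt_min (by positivity) (by norm_num)
  have hev := eventually_exists_periodicOp_eq hA hB hAper hBper τ hμ hY0 hY hδ
  choose! ω' hω' using fun (N : ℕ) (hN : 0 < τ + N) => exists_frequency s.im φ hN
  have hr : Tendsto (fun N : ℕ => τ + (N : ℝ)) atTop atTop :=
    tendsto_atTop_add_const_left _ _ tendsto_natCast_atTop_atTop
  have hr0 : ∀ c : ℝ, Tendsto (fun N : ℕ => c / (τ + (N : ℝ))) atTop (𝓝 0) := fun c =>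
    hr.const_div_atTop c
  have hωlim : Tendsto (fun N : ℕ => ω' N - s.im) atTop (𝓝 0) := by
    refine tendsto_of_tendsto_of_tendsto_of_le_of_le' (hr0 1) (hr0 (1 + 2 * Real.pi)) ?_ ?_
    all_goals
      filter_upwards [hr.eventually_gt_atTop 0] with N hN
      have := (hω' N hN).2
      linarith
  have hp : Tendsto (fun N : ℕ => (((ω' N - s.im : ℝ) : ℂ) * Complex.I,
      ((1 / (τ + N) : ℝ) : ℂ))) atTop (𝓝 0) := by
    refine Tendsto.prodMk_nhds ?_ ?_
    · have := ((Complex.continuous_ofReal.tendsto 0).comp hωlim).mul_const Complex.I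
      simpa using this
    · have := (Complex.continuous_ofReal.tendsto 0).comp (hr0 1)
      simpa [Function.comp_def] using this
  filter_upwards [hp.eventually hev, eventually_ge_atTop 1, hr.eventually_gt_atTop 1,
    (tendsto_order.1 hωlim).2 (ε / 4) (by positivity),
    -- The gap below `π` is shared equally between `ω' - ω` and `ζ.im / (τ + N)`.
    (tendsto_order.1 hωlim).2 ((Real.pi - s.im) / 2) (by linarith [him.2]),
    (tendsto_order.1 (hr0 (1 / 2))).2 ((Real.pi - s.im) / 2) (by linarith [him.2])]
    with N ⟨ζ, hζ, Z, hZ0, hZ⟩ hN1 hN hωε hωpi hrpi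
  have hrpos : 0 < τ + (N : ℝ) := by linarith
  have hrC : ((τ : ℂ) + N) ≠ 0 := by exact_mod_cast hrpos.ne'
  obtain ⟨⟨m, hm⟩, hlo, hhi⟩ := hω' N hrpos
  have hζd : ‖ζ - (s.re : ℂ)‖ < δ := by simpa [dist_eq_norm] using hζ
  have hre : |ζ.re - s.re| < δ := by
    have := (Complex.abs_re_le_norm (ζ - (s.re : ℂ))).trans_lt hζd
    simpa using this
  have him' : |ζ.im| < δ := by
    have := (Complex.abs_im_le_norm (ζ - (s.re : ℂ))).trans_lt hζd
    simpa using this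
  have hδ1 : δ ≤ ε / 4 := min_le_left _ _
  have hδ2 : δ ≤ 1 / 2 := min_le_right _ _
  have hq : |ζ.im / (τ + N)| ≤ |ζ.im| := by
    rw [abs_div, abs_of_pos hrpos]
    exact div_le_self (abs_nonneg _) hN.le
  have hq1 : -(1 / (τ + N)) ≤ ζ.im / (τ + N) := by
    rw [← neg_div]
    gcongr
    linarith [(abs_lt.1 him').1]
  have hq2 : ζ.im / (τ + N) ≤ 1 / 2 / (τ + N) := by
    gcongr
    linarith [(abs_lt.1 him').2]
  have hlo' : 0 ≤ 1 / (τ + (N : ℝ)) := by positivity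
  -- `unscale` divides only the real part, so the imaginary part of `ζ / (τ + N)` is absorbed into
  -- the frequency.
  have hun : unscale τ N ⟨ζ.re, ω' N + ζ.im / (τ + N)⟩ = (s.im : ℂ) * Complex.I +
      ((ω' N - s.im : ℝ) : ℂ) * Complex.I + ((1 / (τ + N) : ℝ) : ℂ) * ζ := by
    conv_rhs => rw [← Complex.re_add_im ζ]
    unfold unscale
    push_cast
    rw [add_comm (N : ℂ)]
    field_simp
    ring
  refine ⟨⟨ζ.re, ω' N + ζ.im / (τ + N)⟩, ⟨⟨?_, ?_⟩, ?_⟩, ?_⟩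
  · simp only
    linarith [him.1]
  · simp only
    linarith
  · refine isFloquetExponent_of_periodicOp_eq hA hB hAper hBper hτ hN1 hZ0 ?_
    rw [hun]
    convert hZ using 3
    -- The choice of `ω'` makes the two exponents differ by `-m` times `2πi`.
    rw [Complex.exp_eq_exp_iff_exists_int]
    refine ⟨-m, ?_⟩
    have hmC : (ω' N : ℂ) * (τ + N) = φ + m * (2 * Real.pi) := by exact_mod_cast hm
    push_cast
    have h1 : 1 / ((τ : ℂ) + N) * (τ + N) = 1 := one_div_mul_cancel hrC
    linear_combination (-Complex.I) * hmC - ζ * h1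
  · rw [dist_eq_norm]
    refine (Complex.norm_le_abs_re_add_abs_im _).trans_lt ?_
    have e1 : |ω' N + ζ.im / (τ + N) - s.im| < ε / 4 + ε / 4 := by
      rw [abs_lt]
      have := abs_lt.1 (hq.trans_lt him')
      constructor <;> linarith
    simp only [Complex.sub_re, Complex.sub_im]
    linarith

end LargeDelayDDE

theorem mainTheorem5 {n : ℕ} (A B : ℝ → Matrix (Fin n) (Fin n) ℝ)
    (hA : Continuous A) (hB : Continuous B)
    (hAper : Function.Periodic A 1) (hBper : Function.Periodic B 1)
    (τ : ℝ) (hτ : τ ∈ Ico (0 : ℝ) 1)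
    (hSig : ∀ μ ∈ LargeDelayDDE.instantaneousSpectrum A, μ.re ≠ 0)
    (R R₂ : ℝ) (s_star : ℂ)
    (hγ : s_star.re ∈ Icc (-R) R₂)
    (hs : s_star ∈ LargeDelayDDE.asymptoticContinuousSpectrum A B τ) :
    (∃ s : ℕ → ℂ,
      Tendsto s atTop (𝓝 s_star) ∧
      (∀ᶠ N in atTop, (s N).im ∈ Ico (-Real.pi) Real.pi ∧
        LargeDelayDDE.IsFloquetExponent A B τ N (LargeDelayDDE.unscale τ N (s N))) ∧
      (s_star.re ∈ Ioo (-R) R₂ →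
        ∀ᶠ N in atTop, LargeDelayDDE.IsScaledFloquetExponent A B τ N R R₂ (s N))) ∧
    (0 < s_star.re →
      ∀ᶠ N : ℕ in atTop, ∃ ev : ℂ, LargeDelayDDE.IsFloquetMultiplier A B τ N ev ∧ 1 < ‖ev‖) := by
  obtain ⟨s, hlim, hZ⟩ := LargeDelayDDE.exists_seq_tendsto_of_eventually fun ε hε =>
    LargeDelayDDE.eventually_exists_floquetExponent hA hB hAper hBper hτ.1 hSig hs (ε := ε) hε
  have hre : Tendsto (fun N => (s N).re) atTop (𝓝 s_star.re) :=
    (Complex.continuous_re.tendsto _).comp hlim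
  refine ⟨⟨s, hlim, hZ, fun hmem => ?_⟩, fun hpos => ?_⟩
  · filter_upwards [hZ, hre.eventually (isOpen_Ioo.mem_nhds hmem)] with N hN hN'
    exact ⟨Ioo_subset_Icc_self hN', hN.1, hN.2⟩
  · filter_upwards [hZ, hre.eventually (lt_mem_nhds hpos), eventually_ge_atTop 1] with N hN hN' hN1
    refine ⟨_, hN.2, ?_⟩
    have h1 : (1 : ℝ) ≤ N := by exact_mod_cast hN1
    have h2 : 0 < (N : ℝ) + τ := by linarith [hτ.1]
    have h3 : (LargeDelayDDE.unscale τ N (s N)).re = (s N).re / (N + τ) := by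
      simp [LargeDelayDDE.unscale, -Complex.ofReal_div]
    rw [Complex.norm_exp, h3, Real.one_lt_exp_iff]
    exact div_pos hN' h2
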